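/- Let $\lambda,\mu\ge 0$, $0<r_e<r_o$, $v_s>0$, $\omega_e\in\mathbb R$ and $r_o-r_e\le\gamma\le\sqrt{r_o^2-r_e^2}$, and put $$\xi=\arccos\!\Big(\frac{r_e^2+r_o^2-\gamma^2}{2r_er_o}\Big).$$ An orbit is a circle of radius $r_o$ about the origin of $\mathbb R^3$, given by its longitude $\theta$ (the angle from the $x$-axis to the ascending node) and its inclination $\phi$; the point of it with argument $\omega$ (the angle from the ascending node) is $$X(\theta,\phi,\omega)=r_o\big(\cos\omega\cos\theta-\sin\omega\cos\phi\sin\theta,\ \cos\omega\sin\theta+\sin\omega\cos\phi\cos\theta,\ \sin\omega\sin\phi\big).$$ The orbits $(\theta,\phi)$ form a Poisson point process $\mathcal O$ on $[0,\pi]^2$ with intensity $\frac{\lambda}{2\pi}\sin\phi\,d\theta\,d\phi$. Conditionally on $\mathcal O$, the satellites at time $0$ form independent Poisson point processes on the orbits, of intensity $\mu/(2\pi r_o)$ per unit arc length. Every satellite moves along its orbit with speed $v_s$, while the longitudes of the orbits rotate with angular speed $\omega_e$: a satellite with parameters $(\theta,\phi,\omega)$ at time $0$ is at $X(\theta+\omega_e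 t,\ \phi,\ \omega+\frac{v_s}{r_o}t)$ at time $t$. The typical user is at $(0,0,r_e)$. Let $I_t$ be the event that at time $t$ at least one satellite is within distance $\gamma$ (that is, at distance at most $\gamma$) of the typical user. Put $$\mathcal F=1-\exp\!\Big(-\lambda\int_0^{\xi}\cos\varphi\,\Big(1-\exp\!\Big(-\frac{\mu}{\pi}\arcsin\sqrt{1-\cos^2\xi\,\sec^2\varphi}\Big)\Big)d\varphi\Big).$$ The harvest time fraction equals $\mathcal F$, in the following sense. The long-run fraction of time $$F_\infty=\lim_{T\to\infty}\frac1T\,\big|\{t\in[0,T]: I_t \text{ occurs}\}\big|$$ exists almost surely, and its mean is $\mathbb E[F_\infty]=\mathcal F$. Moreover the fraction $\frac1T|\{t\in[0,T]: I_t\text{ occurs}\}|$ has mean $\mathcal F$ for every $T>0$, and $\mathbb P(I_t)=\mathcal F$ for every time $t$. -/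

import Mathlib

open MeasureTheory ProbabilityTheory Filter Topology

namespace LEO

/-! ### Point processes -/

section PointProcess

variable {Ω E : Type*} [MeasurableSpace Ω] [MeasurableSpace E]

/-- A finite point process on `E`: a random element of the space of measures (with the
`σ`-algebra generated by the evaluations) each of whose values is a finite sum of Dirac
measures, with multiplicities allowed. -/
structure IsFinitePointProcess (N : Ω → Measure E) : Prop where
  measurable : Measurable N
  counting : ∀ ω, ∃ s : Multiset E, N ω = (s.map fun x => Measure.dirac x).sum

/-- `N` is, under `P`, a Poisson point process on `E` with the finite intensity measure `L`:
counts are Poisson distributed, and counts of disjoint sets are independent. -/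
structure IsPoissonProcess (P : Measure Ω) (N : Ω → Measure E) (L : Measure E) : Prop
    extends IsFinitePointProcess N where
  law_count : ∀ B : Set E, MeasurableSet B →
    P.map (fun ω => N ω B) = (poissonMeasure (L B).toNNReal).map (fun k : ℕ => (k : ENNReal))
  indep_count : ∀ (n : ℕ) (B : Fin n → Set E), (∀ i, MeasurableSet (B i)) →
    Pairwise (fun i j => Disjoint (B i) (B j)) →
    iIndepFun (fun i ω => N ω (B i)) P

/-- `N` is, under `P`, a Cox process: conditionally on the random measure `O` (possibly on
another space), it is a Poisson point process with the finite intensity measure `M (O ω)`.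
In other words, given `O`, the counts of disjoint sets `B i` are independent Poisson variables
with means `M (O ω) (B i)`. -/
structure IsCoxProcess {F : Type*} [MeasurableSpace F] (P : Measure Ω)
    (N : Ω → Measure E) (O : Ω → Measure F) (M : Measure F → Measure E) : Prop
    extends IsFinitePointProcess N where
  cond_law : ∀ (n : ℕ) (B : Fin n → Set E), (∀ i, MeasurableSet (B i)) →
    Pairwise (fun i j => Disjoint (B i) (B j)) → ∀ k : Fin n → ℕ,
    P[({ω | ∀ i, N ω (B i) = (k i : ENNReal)}).indicator (fun _ => (1 : ℝ)) |
        MeasurableSpace.comap O inferInstance]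
      =ᵐ[P] fun ω => ∏ i, Real.exp (-(M (O ω) (B i)).toReal) *
        (M (O ω) (B i)).toReal ^ (k i) / ((k i).factorial : ℝ)

end PointProcess

/-! ### Geometry -/

/-- The point of the sphere of radius `ro` about the origin which lies on the orbit with
longitude `θ` of the ascending node and inclination `φ`, at argument `ω`, the angle from the
ascending node measured on the orbit. -/
noncomputable def orbitPoint (ro θ φ ω : ℝ) : EuclideanSpace ℝ (Fin 3) :=
  !₂[ro * (Real.cos ω * Real.cos θ - Real.sin ω * Real.cos φ * Real.sin θ),
     ro * (Real.cos ω * Real.sin θ + Real.sin ω * Real.cos φ * Real.cos θ),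
     ro * (Real.sin ω * Real.sin φ)]

/-- The position at time `t` of the satellite that starts at `x = ((θ, φ), ω)`: it runs along
its orbit with speed `vs`, that is with angular speed `vs / ro`, while the longitude of the
orbit, seen from the Earth, rotates with angular speed `we`. -/
noncomputable def satPosition (ro vs we t : ℝ) (x : (ℝ × ℝ) × ℝ) : EuclideanSpace ℝ (Fin 3) :=
  orbitPoint ro (x.1.1 + we * t) x.1.2 (x.2 + vs / ro * t)

/-- The location `(0, 0, re)` of the typical user. -/
noncomputable def typicalUser (re : ℝ) : EuclideanSpace ℝ (Fin 3) := !₂[0, 0, re]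

/-- The azimuth angle `ξ` of the cap of points at distance at most `γ` from the typical user. -/
noncomputable def capAngle (re ro γ : ℝ) : ℝ :=
  Real.arccos ((re ^ 2 + ro ^ 2 - γ ^ 2) / (2 * re * ro))

/-! ### The satellite constellation -/

/-- The intensity measure of the orbit process: density `lam / (2 π) * sin φ` with respect to
`dθ dφ` on the rectangle `[0, π] × [0, π]`. -/
noncomputable def orbitIntensity (lam : ℝ) : Measure (ℝ × ℝ) :=
  (volume.restrict (Set.Icc 0 Real.pi ×ˢ Set.Icc 0 Real.pi)).withDensity
    (fun x => ENNReal.ofReal (lam / (2 * Real.pi) * Real.sin x.2))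

/-- The conditional intensity of the satellites given the orbits, in the coordinates
`((θ, φ), ω)`: on each orbit the arc length measure `ro dω` times `mu / (2 π ro)`. -/
noncomputable def satIntensity (ro mu : ℝ) (O : Measure (ℝ × ℝ)) : Measure ((ℝ × ℝ) × ℝ) :=
  O.prod (ENNReal.ofReal (mu / (2 * Real.pi * ro) * ro) •
    volume.restrict (Set.Ico 0 (2 * Real.pi)))

/-- The Cox model at time `0`. `O` is the Poisson process of the orbits `(θ, φ)`; given `O`,
there are independent Poisson processes of satellites on the orbits. A satellite is recorded in
`S` as `((θ, φ), ω)`, its orbit together with its argument on this orbit. -/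
structure IsCoxConstellation {Ω : Type*} [MeasurableSpace Ω] (P : Measure Ω) (lam mu ro : ℝ)
    (O : Ω → Measure (ℝ × ℝ)) (S : Ω → Measure ((ℝ × ℝ) × ℝ)) : Prop where
  orbits : IsPoissonProcess P O (orbitIntensity lam)
  satellites : IsCoxProcess P S O (satIntensity ro mu)

section Harvest

variable {Ω : Type*}

/-- The counting measure on space of the positions of all satellites at time `t`. -/
noncomputable def satellitesAt (S : Ω → Measure ((ℝ × ℝ) × ℝ)) (ro vs we t : ℝ) (ω : Ω) :
    Measure (EuclideanSpace ℝ (Fin 3)) :=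
  (S ω).map (satPosition ro vs we t)

/-- At time `t` the typical user has at least one satellite within distance `γ`. -/
def InRange (S : Ω → Measure ((ℝ × ℝ) × ℝ)) (re ro γ vs we t : ℝ) (ω : Ω) : Prop :=
  1 ≤ satellitesAt S ro vs we t ω (Metric.closedBall (typicalUser re) γ)

/-- The fraction of the time window `[0, T]` in which the typical user has at least one
satellite within distance `γ`. -/
noncomputable def timeFraction (S : Ω → Measure ((ℝ × ℝ) × ℝ)) (re ro γ vs we T : ℝ) (ω : Ω) :
    ℝ :=
  (volume {t ∈ Set.Icc 0 T | InRange S re ro γ vs we t ω}).toReal / T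

end Harvest

/-- The closed form of the harvest time fraction. -/
noncomputable def harvestFormula (lam mu ξ : ℝ) : ℝ :=
  1 - Real.exp (-lam * ∫ φ in (0 : ℝ)..ξ, Real.cos φ *
    (1 - Real.exp (-(mu / Real.pi) *
      Real.arcsin (Real.sqrt (1 - Real.cos ξ ^ 2 * (1 / Real.cos φ) ^ 2)))))

end LEO

/-!
The satellite with parameters `((θ, φ), ω)` is within distance `γ` of the user exactly when its
height along the axis of the user is large enough: `ro cos ξ ≤ ro sin ω' sin φ`, where `ω'` is its current
argument (`satPosition_mem_closedBall_iff`). So the longitude, and with it the rotation of the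
orbits, is irrelevant, and the event of being in range says that the counting measure `S` charges
a set `visibleSet` that depends on time only through a shift of the arguments.

*One time.* Given the orbits, this set carries no satellite with probability `exp (-m)`,
where `m` is its conditional intensity (`IsCoxProcess.measureReal_apply_eq_zero`). By periodicity
of the arguments `m` does not depend on the shift: it is the integral over the orbit process of `mu / (2 π)` times
the length `2 arccos (cos ξ / sin φ)` of the visible arc of the orbit (`satIntensity_visibleSet`,
`volume_cos_ge`). The expectation of `exp (-m)` is therefore a Laplace functional of the Poisson
process of orbits, which follows from the independence of the counts for simple functions and
by monotone approximation in general (`IsPoissonProcess.integral_exp_neg_lintegral`). The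
substitution `φ = π / 2 - ψ` gives the closed form (`integral_sin_mul_visibleArc`).

*Time averages.* As the probability is the same at all times, Fubini gives the mean fraction of
time in every window (`integral_timeFraction`). On every sample path, being in range is periodic
in time with the period of revolution of the satellites, so that the long-run fraction exists and
equals the fraction over one period (`tendsto_timeFraction`); its mean is thus known already.
-/

open MeasureTheory ProbabilityTheory Filter Topology

namespace LEO

/-! ### Void probabilities and Laplace functionals -/

section

variable {Ω E : Type*} [MeasurableSpace Ω] [MeasurableSpace E]

lemma exists_natCast_apply_of_multiset_dirac (s : Multiset E) {B : Set E} (hB : MeasurableSet B) :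
    ∃ k : ℕ, (s.map fun x => Measure.dirac x).sum B = (k : ENNReal) := by
  classical
  induction s using Multiset.induction_on with
  | empty => exact ⟨0, by simp⟩
  | cons a s ih =>
    obtain ⟨k, hk⟩ := ih
    rw [Multiset.map_cons, Multiset.sum_cons, Measure.add_apply, hk, Measure.dirac_apply' _ hB]
    by_cases h : a ∈ B
    · exact ⟨k + 1, by simp [h, add_comm]⟩
    · exact ⟨k, by simp [h]⟩

lemma IsFinitePointProcess.exists_natCast_apply {N : Ω → Measure E} (hN : IsFinitePointProcess N)
    (ω : Ω) {B : Set E} (hB : MeasurableSet B) : ∃ k : ℕ, N ω B = (k : ENNReal) := by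
  obtain ⟨s, hs⟩ := hN.counting ω
  rw [hs]
  exact exists_natCast_apply_of_multiset_dirac s hB

lemma IsFinitePointProcess.isFiniteMeasure {N : Ω → Measure E} (hN : IsFinitePointProcess N)
    (ω : Ω) : IsFiniteMeasure (N ω) := by
  obtain ⟨k, hk⟩ := hN.exists_natCast_apply ω MeasurableSet.univ
  exact ⟨by rw [hk]; exact ENNReal.natCast_lt_top k⟩

lemma IsFinitePointProcess.one_le_iff {N : Ω → Measure E} (hN : IsFinitePointProcess N)
    (ω : Ω) {B : Set E} (hB : MeasurableSet B) : 1 ≤ N ω B ↔ N ω B ≠ 0 := by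
  obtain ⟨k, hk⟩ := hN.exists_natCast_apply ω hB
  rw [hk]
  norm_cast
  omega

/-- The sections of a measurable set of `T × E` have jointly measurable counts. -/
lemma IsFinitePointProcess.measurable_apply_section {T : Type*} [MeasurableSpace T]
    {N : Ω → Measure E} (hN : IsFinitePointProcess N) {B : Set (T × E)} (hB : MeasurableSet B) :
    Measurable fun p : T × Ω => N p.2 (Prod.mk p.1 ⁻¹' B) := by
  let κ : Kernel (T × Ω) E := ⟨fun p => N p.2, hN.measurable.comp measurable_snd⟩
  have h := Kernel.measurable_kernel_prodMk_left_of_finite (κ := κ)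
    (t := (fun q : (T × Ω) × E => (q.1.1, q.2)) ⁻¹' B)
    ((by fun_prop : Measurable fun q : (T × Ω) × E => (q.1.1, q.2)) hB)
    (fun p => hN.isFiniteMeasure p.2)
  exact h

/-- Laplace transform of the Poisson distribution. -/
lemma integral_exp_neg_mul_poissonMeasure (r : NNReal) (y : ℝ) :
    ∫ k : ℕ, Real.exp (-(y * k)) ∂(poissonMeasure r) = Real.exp (-((1 - Real.exp (-y)) * r)) := by
  rw [integral_poissonMeasure]
  have h : HasSum (fun n : ℕ => Real.exp (-r) * ((r * Real.exp (-y)) ^ n / (n.factorial : ℝ)))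
      (Real.exp (-r) * Real.exp (r * Real.exp (-y))) := by
    have h0 := NormedSpace.expSeries_div_hasSum_exp ((r : ℝ) * Real.exp (-y))
    rw [← Real.exp_eq_exp_ℝ] at h0
    exact h0.mul_left _
  have he : Real.exp (-r) * Real.exp (r * Real.exp (-y)) =
      Real.exp (-((1 - Real.exp (-y)) * r)) := by
    rw [← Real.exp_add]; congr 1; ring
  rw [← he, ← h.tsum_eq]
  refine tsum_congr fun n => ?_
  rw [smul_eq_mul, mul_pow, ← Real.exp_nat_mul]
  have : -(y * n) = n * -y := by ring
  rw [this]
  ring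

variable {P : Measure Ω} {N : Ω → Measure E} {L : Measure E}

lemma IsPoissonProcess.integral_exp_neg_mul (hN : IsPoissonProcess P N L)
    {B : Set E} (hB : MeasurableSet B) (y : ℝ) :
    ∫ ω, Real.exp (-(y * (N ω B).toReal)) ∂P =
      Real.exp (-((1 - Real.exp (-y)) * (L B).toReal)) := by
  have hm : Measurable fun z : ENNReal => Real.exp (-(y * z.toReal)) := by fun_prop
  have hc : Measurable fun ω => N ω B := (Measure.measurable_coe hB).comp hN.measurable
  rw [← integral_map (φ := fun ω => N ω B) (f := fun z : ENNReal => Real.exp (-(y * z.toReal)))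
    hc.aemeasurable hm.aestronglyMeasurable, hN.law_count B hB,
    integral_map Measurable.of_discrete.aemeasurable hm.aestronglyMeasurable]
  simp only [ENNReal.toReal_natCast]
  exact integral_exp_neg_mul_poissonMeasure _ _

/-- The Laplace functional on simple functions, where it is a finite product of Laplace
transforms of independent Poisson counts. -/
lemma IsPoissonProcess.integral_exp_neg_lintegral_simpleFunc [IsFiniteMeasure L]
    (hN : IsPoissonProcess P N L) (f : SimpleFunc E ENNReal) (hf : ∀ x, f x < ⊤) :
    ∫ ω, Real.exp (-(∫⁻ x, f x ∂(N ω)).toReal) ∂P =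
      Real.exp (-∫ x, (1 - Real.exp (-(f x).toReal)) ∂L) := by
  -- The counts are independent on the level sets of `f`.
  let e := f.range.equivFin.symm
  let y : Fin f.range.card → ENNReal := fun i => (e i : ENNReal)
  let B : Fin f.range.card → Set E := fun i => f ⁻¹' {y i}
  have hy : ∀ i, y i ≠ ⊤ := fun i => by
    obtain ⟨x, hx⟩ := SimpleFunc.mem_range.1 (e i).2
    change ((e i : ENNReal)) ≠ ⊤
    rw [← hx]
    exact (hf x).ne
  have hB : ∀ i, MeasurableSet (B i) := fun i => f.measurableSet_preimage _
  have hdisj : Pairwise fun i j => Disjoint (B i) (B j) := fun i j hij => by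
    refine Set.disjoint_left.2 fun x hi hj => hij ?_
    have h : y i = y j := by
      rw [← (show f x = y i from hi), ← (show f x = y j from hj)]
    exact e.injective (Subtype.ext h)
  have hsum : ∀ g : ENNReal → ℝ, ∑ z ∈ f.range, g z = ∑ i, g (y i) := fun g => by
    rw [← Finset.sum_coe_sort, ← Equiv.sum_comp e]
  have hint : ∀ ω, (∫⁻ x, f x ∂(N ω)).toReal = ∑ i, (y i).toReal * (N ω (B i)).toReal := by
    intro ω
    have := hN.isFiniteMeasure ω
    rw [SimpleFunc.lintegral_eq_lintegral, SimpleFunc.lintegral, ENNReal.toReal_sum]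
    · rw [hsum fun z => (z * N ω (f ⁻¹' {z})).toReal]
      simp only [ENNReal.toReal_mul, B]
    · intro z hz
      obtain ⟨x, rfl⟩ := SimpleFunc.mem_range.1 hz
      exact ENNReal.mul_ne_top (hf x).ne (measure_ne_top _ _)
  have hL : ∫ x, (1 - Real.exp (-(f x).toReal)) ∂L =
      ∑ i, (1 - Real.exp (-(y i).toReal)) * (L (B i)).toReal := by
    have h0 : ∀ x, 1 - Real.exp (-(f x).toReal) =
        ∑ i, (B i).indicator (fun _ => 1 - Real.exp (-(y i).toReal)) x := by
      intro x
      let i₀ := e.symm ⟨f x, f.mem_range_self x⟩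
      have hi₀ : y i₀ = f x := by simp [y, i₀]
      rw [Finset.sum_eq_single i₀]
      · rw [Set.indicator_of_mem (show x ∈ B i₀ from hi₀.symm), hi₀]
      · intro j _ hj
        refine Set.indicator_of_notMem (fun hx => hj ?_) _
        refine e.injective (Subtype.ext ?_)
        change y j = y i₀
        rw [hi₀]; exact (show f x = y j from hx).symm
      · simp
    simp_rw [h0]
    rw [integral_finsetSum]
    · refine Finset.sum_congr rfl fun i _ => ?_
      rw [integral_indicator (hB i), setIntegral_const, smul_eq_mul, mul_comm]
      rfl
    · intro i _
      exact (integrable_const _).indicator (hB i)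
  simp_rw [hint, hL, ← Finset.sum_neg_distrib, Real.exp_sum]
  have hmeas : ∀ i, Measurable fun ω => N ω (B i) := fun i =>
    (Measure.measurable_coe (hB i)).comp hN.measurable
  rw [(hN.indep_count _ B hB hdisj).integral_fun_prod_comp
    (f := fun i (z : ENNReal) => Real.exp (-((y i).toReal * z.toReal)))
    (fun i => (hmeas i).aemeasurable)
    (fun i => (by fun_prop : Measurable fun z : ENNReal =>
      Real.exp (-((y i).toReal * z.toReal))).aestronglyMeasurable)]
  exact Finset.prod_congr rfl fun i _ => hN.integral_exp_neg_mul (hB i) _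

/-- The Laplace functional of a Poisson process. The bound on `f` keeps all integrals against the
finite measures `N ω` finite, so that `ENNReal.toReal` loses nothing. -/
lemma IsPoissonProcess.integral_exp_neg_lintegral [IsProbabilityMeasure P] [IsFiniteMeasure L]
    (hN : IsPoissonProcess P N L) {f : E → ENNReal} (hf : Measurable f) {C : ENNReal}
    (hC : C ≠ ⊤) (hfC : ∀ x, f x ≤ C) :
    ∫ ω, Real.exp (-(∫⁻ x, f x ∂(N ω)).toReal) ∂P =
      Real.exp (-∫ x, (1 - Real.exp (-(f x).toReal)) ∂L) := by
  have hle : ∀ z : ENNReal, Real.exp (-z.toReal) ≤ 1 := fun z =>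
    Real.exp_le_one_iff.2 (neg_nonpos.2 ENNReal.toReal_nonneg)
  have hlim : ∀ ω, Tendsto (fun n => ∫⁻ x, SimpleFunc.eapprox f n x ∂(N ω)) atTop
      (𝓝 (∫⁻ x, f x ∂(N ω))) := fun ω =>
    lintegral_tendsto_of_tendsto_of_monotone
      (fun n => (SimpleFunc.eapprox f n).measurable.aemeasurable)
      (ae_of_all _ fun x n m h => SimpleFunc.monotone_eapprox f h x)
      (ae_of_all _ fun x => SimpleFunc.tendsto_eapprox hf x)
  have h1 : Tendsto (fun n => ∫ ω, Real.exp (-(∫⁻ x, SimpleFunc.eapprox f n x ∂(N ω)).toReal) ∂P)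
      atTop (𝓝 (∫ ω, Real.exp (-(∫⁻ x, f x ∂(N ω)).toReal) ∂P)) := by
    refine tendsto_integral_of_dominated_convergence (fun _ => (1 : ℝ)) (fun n => ?_)
      (integrable_const _) (fun n => ae_of_all _ fun ω => ?_) (ae_of_all _ fun ω => ?_)
    · have := (Measure.measurable_lintegral (SimpleFunc.eapprox f n).measurable).comp hN.measurable
      exact (Real.measurable_exp.comp this.ennreal_toReal.neg).aestronglyMeasurable
    · rw [Real.norm_of_nonneg (Real.exp_pos _).le]
      exact hle _
    · have := hN.isFiniteMeasure ω
      have hfin : ∫⁻ x, f x ∂(N ω) ≠ ⊤ := by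
        refine ((lintegral_mono hfC).trans_lt ?_).ne
        rw [lintegral_const]
        exact ENNReal.mul_lt_top hC.lt_top (measure_lt_top _ _)
      exact (Real.continuous_exp.tendsto _).comp
        ((ENNReal.tendsto_toReal hfin).comp (hlim ω)).neg
  have h2 : Tendsto (fun n => ∫ x, (1 - Real.exp (-(SimpleFunc.eapprox f n x).toReal)) ∂L)
      atTop (𝓝 (∫ x, (1 - Real.exp (-(f x).toReal)) ∂L)) := by
    refine tendsto_integral_of_dominated_convergence (fun _ => (1 : ℝ)) (fun n => ?_)
      (integrable_const _) (fun n => ae_of_all _ fun x => ?_) (ae_of_all _ fun x => ?_)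
    · have := (SimpleFunc.eapprox f n).measurable
      exact (by fun_prop : Measurable fun x =>
        1 - Real.exp (-(SimpleFunc.eapprox f n x).toReal)).aestronglyMeasurable
    · rw [Real.norm_of_nonneg (sub_nonneg.2 (hle _))]
      linarith [Real.exp_pos (-(SimpleFunc.eapprox f n x).toReal)]
    · have hfin : f x ≠ ⊤ := ((hfC x).trans_lt hC.lt_top).ne
      exact ((Real.continuous_exp.tendsto _).comp
        ((ENNReal.tendsto_toReal hfin).comp (SimpleFunc.tendsto_eapprox hf x)).neg).const_sub 1
  refine tendsto_nhds_unique h1 ?_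
  simp_rw [fun n => hN.integral_exp_neg_lintegral_simpleFunc (SimpleFunc.eapprox f n)
    (SimpleFunc.eapprox_lt_top f n)]
  exact (Real.continuous_exp.tendsto _).comp h2.neg

/-- The void probabilities of a Cox process: the conditional law of a single count, at the value
`0`, integrated. -/
lemma IsCoxProcess.measureReal_apply_eq_zero {F : Type*} [MeasurableSpace F]
    [IsProbabilityMeasure P] {O : Ω → Measure F} {M : Measure F → Measure E}
    (hN : IsCoxProcess P N O M) (hO : Measurable O) {B : Set E} (hB : MeasurableSet B) :
    P.real {ω | N ω B = 0} = ∫ ω, Real.exp (-(M (O ω) B).toReal) ∂P := by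
  have h := hN.cond_law 1 (fun _ => B) (fun _ => hB)
    (fun i j hij => absurd (Subsingleton.elim i j) hij) (fun _ => 0)
  simp only [Nat.cast_zero, forall_const, Finset.univ_unique, Finset.prod_const,
    Finset.card_singleton, pow_one, pow_zero, mul_one, Nat.factorial_zero, Nat.cast_one,
    div_one] at h
  have hmeas : MeasurableSet {ω | N ω B = 0} :=
    (Measure.measurable_coe hB).comp hN.measurable (measurableSet_singleton 0)
  rw [← integral_congr_ae h, integral_condExp hO.comap_le, integral_indicator hmeas]
  simp

end

/-! ### Geometry of the visible cap -/

/-- The parameters `((θ, φ), ω)` of the satellites which, after the arguments have advanced by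
`s`, lie in the cap `c ≤ sin ω sin φ`. The longitude is unconstrained, since the cap is
symmetric about the third axis. -/
def visibleSet (c s : ℝ) : Set ((ℝ × ℝ) × ℝ) :=
  {x | c ≤ Real.sin (x.2 + s) * Real.sin x.1.2}

lemma measurableSet_setOf_visibleSet (c v : ℝ) :
    MeasurableSet {p : ℝ × ((ℝ × ℝ) × ℝ) | p.2 ∈ visibleSet c (v * p.1)} := by
  exact measurableSet_le (f := fun _ => c)
    (g := fun p : ℝ × ((ℝ × ℝ) × ℝ) => Real.sin (p.2.2 + v * p.1) * Real.sin p.2.1.2)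
    (by fun_prop) (by fun_prop)

lemma measurableSet_visibleSet (c s : ℝ) : MeasurableSet (visibleSet c s) := by
  unfold visibleSet
  exact measurableSet_le (by fun_prop) (by fun_prop)

lemma measurable_satPosition (ro vs we t : ℝ) : Measurable (satPosition ro vs we t) := by
  unfold satPosition orbitPoint
  refine (WithLp.measurable_toLp 2 _).comp (measurable_pi_lambda _ fun i => ?_)
  fin_cases i <;> simp <;> fun_prop

/-- The bounds on `γ` make the argument of `arccos` in `capAngle` lie in `(0, 1]`; it is positive
because the cap stays above the horizontal plane through the centre of the Earth. -/
lemma cos_capAngle {re ro γ : ℝ} (hre : 0 < re) (hro : re < ro)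
    (hγ : γ ∈ Set.Icc (ro - re) (Real.sqrt (ro ^ 2 - re ^ 2))) :
    Real.cos (capAngle re ro γ) = (re ^ 2 + ro ^ 2 - γ ^ 2) / (2 * re * ro) ∧
      0 < Real.cos (capAngle re ro γ) := by
  have hro0 : 0 < ro := hre.trans hro
  have hγ0 : 0 ≤ γ := (sub_nonneg.2 hro.le).trans hγ.1
  have h1 : (ro - re) ^ 2 ≤ γ ^ 2 := by
    have := sub_pos.2 hro
    nlinarith [hγ.1]
  have h2 : γ ^ 2 ≤ ro ^ 2 - re ^ 2 := by
    rw [← Real.le_sqrt' (lt_of_lt_of_le (sub_pos.2 hro) hγ.1)]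
    exact hγ.2
  have hd : 0 < 2 * re * ro := by positivity
  have hpos : 0 < (re ^ 2 + ro ^ 2 - γ ^ 2) / (2 * re * ro) :=
    div_pos (by nlinarith) hd
  have hle : (re ^ 2 + ro ^ 2 - γ ^ 2) / (2 * re * ro) ≤ 1 :=
    (div_le_one hd).2 (by nlinarith)
  have : Real.cos (capAngle re ro γ) = (re ^ 2 + ro ^ 2 - γ ^ 2) / (2 * re * ro) :=
    Real.cos_arccos (by linarith) hle
  exact ⟨this, this ▸ hpos⟩

/-- By the law of cosines the distance from the user depends only on the height
`ro sin ω sin φ`, so the rotation of the orbits plays no role. -/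
lemma satPosition_mem_closedBall_iff {re ro γ : ℝ} (hre : 0 < re) (hro : re < ro)
    (hγ : γ ∈ Set.Icc (ro - re) (Real.sqrt (ro ^ 2 - re ^ 2))) (vs we t : ℝ)
    (x : (ℝ × ℝ) × ℝ) :
    satPosition ro vs we t x ∈ Metric.closedBall (typicalUser re) γ ↔
      x ∈ visibleSet (Real.cos (capAngle re ro γ)) (vs / ro * t) := by
  have hro0 : 0 < ro := hre.trans hro
  have hγ0 : 0 ≤ γ := (sub_nonneg.2 hro.le).trans hγ.1
  have hd : 0 < 2 * re * ro := by positivity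
  rw [(cos_capAngle hre hro hγ).1]
  rw [Metric.mem_closedBall, EuclideanSpace.dist_eq, Real.sqrt_le_left hγ0, visibleSet,
    Set.mem_ofPred_eq, div_le_iff₀ hd, Fin.sum_univ_three]
  simp only [satPosition, orbitPoint, typicalUser, Real.dist_eq, sq_abs]
  simp only [Matrix.cons_val_zero, Matrix.cons_val_one, Matrix.cons_val]
  set w := x.2 + vs / ro * t
  set θ := x.1.1 + we * t
  set φ := x.1.2
  have e : (ro * (Real.cos w * Real.cos θ - Real.sin w * Real.cos φ * Real.sin θ) - 0) ^ 2 +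
      (ro * (Real.cos w * Real.sin θ + Real.sin w * Real.cos φ * Real.cos θ) - 0) ^ 2 +
      (ro * (Real.sin w * Real.sin φ) - re) ^ 2 =
      ro ^ 2 + re ^ 2 - Real.sin w * Real.sin φ * (2 * re * ro) := by
    have hw := Real.sin_sq_add_cos_sq w
    have hθ := Real.sin_sq_add_cos_sq θ
    have hφ := Real.sin_sq_add_cos_sq φ
    have hw' : Real.cos w ^ 2 = 1 - Real.sin w ^ 2 := by linarith
    have hθ' : Real.cos θ ^ 2 = 1 - Real.sin θ ^ 2 := by linarith
    have hφ' : Real.cos φ ^ 2 = 1 - Real.sin φ ^ 2 := by linarith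
    ring_nf
    rw [hw', hθ', hφ']
    ring
  rw [e]
  constructor <;> intro h <;> linarith

/-- By periodicity the length of the set of visible arguments does not depend on the shift `s`,
and the sine may be replaced by the cosine, for which this set is an interval about `0`. -/
lemma volume_arg_visible (c a s : ℝ) :
    volume {w ∈ Set.Ico 0 (2 * Real.pi) | c ≤ Real.sin (w + s) * a} =
      volume {u ∈ Set.Ioc (-Real.pi) Real.pi | c ≤ Real.cos u * a} := by
  have hpi := Real.pi_pos
  have key : ∀ x y : ℝ, ∫ w in x..x + 2 * Real.pi,
      ({u | c ≤ Real.cos u * a}.indicator (fun _ => (1 : ℝ))) w =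
      ∫ w in y..y + 2 * Real.pi, ({u | c ≤ Real.cos u * a}.indicator (fun _ => (1 : ℝ))) w := by
    intro x y
    refine Function.Periodic.intervalIntegral_add_eq (fun w => ?_) x y
    simp only [Set.indicator, Set.mem_ofPred_eq, Real.cos_add_two_pi]
  have hms : MeasurableSet {u | c ≤ Real.cos u * a} :=
    measurableSet_le (by fun_prop) (by fun_prop)
  have hI : ∀ x, ∫ w in x..x + 2 * Real.pi,
      ({u | c ≤ Real.cos u * a}.indicator (fun _ => (1 : ℝ))) w =
      volume.real {u ∈ Set.Ioc x (x + 2 * Real.pi) | c ≤ Real.cos u * a} := by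
    intro x
    rw [intervalIntegral.integral_of_le (by linarith), setIntegral_indicator hms,
      setIntegral_const, smul_eq_mul, mul_one]
    rfl
  -- `u = w + s - π / 2` turns `sin (w + s)` into `cos u`.
  have h1 := key (s - Real.pi / 2) (-Real.pi)
  rw [hI, hI] at h1
  have e1 : -Real.pi + 2 * Real.pi = Real.pi := by ring
  rw [e1] at h1
  have hfin : ∀ x y : ℝ, volume {u ∈ Set.Ioc x y | c ≤ Real.cos u * a} ≠ ⊤ := fun x y =>
    ((measure_mono (Set.sep_subset _ _)).trans_lt measure_Ioc_lt_top).ne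
  rw [measureReal_def, measureReal_def, ENNReal.toReal_eq_toReal_iff' (hfin _ _) (hfin _ _)] at h1
  rw [← h1, ← measure_preimage_add_right volume (s - Real.pi / 2)
    {u ∈ Set.Ioc (s - Real.pi / 2) (s - Real.pi / 2 + 2 * Real.pi) | c ≤ Real.cos u * a}]
  refine measure_congr ?_
  have hae : Set.Ico 0 (2 * Real.pi) =ᵐ[volume] Set.Ioc 0 (2 * Real.pi) :=
    Ico_ae_eq_Ioc
  have hset : (fun w => w + (s - Real.pi / 2)) ⁻¹'
      {u ∈ Set.Ioc (s - Real.pi / 2) (s - Real.pi / 2 + 2 * Real.pi) | c ≤ Real.cos u * a} =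
      Set.Ioc 0 (2 * Real.pi) ∩ {w | c ≤ Real.sin (w + s) * a} := by
    ext w
    have : Real.cos (w + (s - Real.pi / 2)) = Real.sin (w + s) := by
      rw [← add_sub_assoc, Real.cos_sub_pi_div_two]
    simp only [Set.mem_preimage, Set.mem_ofPred_eq, Set.mem_Ioc, Set.mem_inter_iff, this]
    constructor <;> rintro ⟨⟨h1, h2⟩, h3⟩ <;> exact ⟨⟨by linarith, by linarith⟩, h3⟩
  rw [hset]
  exact hae.inter (ae_eq_refl _)

lemma volume_cos_ge {c a : ℝ} (hc : 0 < c) (hca : c ≤ a) :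
    volume {u ∈ Set.Ioc (-Real.pi) Real.pi | c ≤ Real.cos u * a} =
      ENNReal.ofReal (2 * Real.arccos (c / a)) := by
  have ha : 0 < a := hc.trans_le hca
  have hb0 : 0 < c / a := div_pos hc ha
  have hb1 : c / a ≤ 1 := (div_le_one ha).2 hca
  have hacos : Real.arccos (c / a) < Real.pi := by
    have := Real.arccos_lt_pi_div_two.2 hb0
    linarith [Real.pi_pos]
  have hset : {u ∈ Set.Ioc (-Real.pi) Real.pi | c ≤ Real.cos u * a} =
      Set.Icc (-Real.arccos (c / a)) (Real.arccos (c / a)) := by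
    ext u
    rw [Set.mem_Icc, ← abs_le]
    have hiff : |u| ≤ Real.pi → (c ≤ Real.cos u * a ↔ |u| ≤ Real.arccos (c / a)) := by
      intro hu
      rw [← div_le_iff₀ ha, ← Real.cos_abs u,
        ← Real.strictAntiOn_cos.le_iff_ge ⟨Real.arccos_nonneg _, hacos.le⟩ ⟨abs_nonneg u, hu⟩,
        Real.cos_arccos (by linarith) hb1]
    constructor
    · rintro ⟨⟨h1, h2⟩, h3⟩
      exact (hiff (abs_le.2 ⟨h1.le, h2⟩)).1 h3
    · intro h
      have h' := abs_lt.1 (h.trans_lt hacos)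
      exact ⟨⟨h'.1, h'.2.le⟩, (hiff (h.trans hacos.le)).2 h⟩
  rw [hset, Real.volume_Icc]
  congr 1
  ring

/-- Here `a = 0` is allowed, where `arccos (c / a)` would be wrong. -/
lemma volume_cos_ge_of_lt {c a : ℝ} (ha : 0 ≤ a) (hca : a < c) :
    volume {u ∈ Set.Ioc (-Real.pi) Real.pi | c ≤ Real.cos u * a} = 0 := by
  convert! measure_empty (μ := volume (α := ℝ))
  refine Set.eq_empty_of_forall_notMem fun u hu => ?_
  have h := hu.2
  nlinarith [Real.cos_le_one u]

/-- The length of the arc of an orbit, as an angle, that is visible to the user, when the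
normal of the orbital plane makes the angle `φ` with the axis of the cap. -/
noncomputable def visibleArc (c φ : ℝ) : ENNReal :=
  volume {u ∈ Set.Ioc (-Real.pi) Real.pi | c ≤ Real.cos u * Real.sin φ}

lemma measurable_visibleArc (c : ℝ) : Measurable (visibleArc c) := by
  have hm : MeasurableSet
      {p : ℝ × ℝ | p.2 ∈ Set.Ioc (-Real.pi) Real.pi ∧ c ≤ Real.cos p.2 * Real.sin p.1} :=
    (measurable_snd measurableSet_Ioc).inter (measurableSet_le (f := fun _ => c)
      (g := fun p : ℝ × ℝ => Real.cos p.2 * Real.sin p.1) (by fun_prop) (by fun_prop))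
  exact measurable_measure_prodMk_left hm

lemma visibleArc_le (c φ : ℝ) : visibleArc c φ ≤ ENNReal.ofReal (2 * Real.pi) := by
  refine (measure_mono (Set.sep_subset _ _)).trans ?_
  rw [Real.volume_Ioc]
  exact ENNReal.ofReal_le_ofReal (by linarith)

lemma satIntensity_visibleSet {mu c s : ℝ} (hro : 0 < ro) (O : Measure (ℝ × ℝ)) :
    satIntensity ro mu O (visibleSet c s) =
      ∫⁻ x, ENNReal.ofReal (mu / (2 * Real.pi)) * visibleArc c x.2 ∂O := by
  have hmu : mu / (2 * Real.pi * ro) * ro = mu / (2 * Real.pi) := by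
    field_simp
  rw [satIntensity, Measure.prod_apply (measurableSet_visibleSet c s), hmu]
  refine lintegral_congr fun x => ?_
  rw [Measure.smul_apply, smul_eq_mul, Measure.restrict_apply
    (measurable_prodMk_left (measurableSet_visibleSet c s)), visibleArc,
    ← volume_arg_visible c _ s, Set.inter_comm]
  rfl

/-- The integral over the inclinations in the Laplace functional. The deviation `ψ = π / 2 - φ`
from the polar orbit turns it into that of the closed form; by symmetry the range of
integration may be halved, and orbits with `ψ > ξ` do not meet the cap. -/
lemma integral_sin_mul_visibleArc {ξ mu : ℝ} (hmu : 0 ≤ mu) (hξ0 : 0 ≤ ξ)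
    (hξ : ξ < Real.pi / 2) :
    ∫ φ in (0 : ℝ)..Real.pi, Real.sin φ *
      (1 - Real.exp (-(ENNReal.ofReal (mu / (2 * Real.pi)) *
        visibleArc (Real.cos ξ) φ).toReal)) =
    2 * ∫ φ in (0 : ℝ)..ξ, Real.cos φ *
      (1 - Real.exp (-(mu / Real.pi) *
        Real.arcsin (Real.sqrt (1 - Real.cos ξ ^ 2 * (1 / Real.cos φ) ^ 2)))) := by
  have hpi := Real.pi_pos
  have hc : 0 < Real.cos ξ := Real.cos_pos_of_mem_Ioo ⟨by linarith, hξ⟩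
  set G : ℝ → ℝ := fun φ => Real.sin φ *
      (1 - Real.exp (-(ENNReal.ofReal (mu / (2 * Real.pi)) *
        visibleArc (Real.cos ξ) φ).toReal)) with hG
  have hGm : Measurable G := by
    have := measurable_visibleArc (Real.cos ξ)
    fun_prop
  have hGb : ∀ φ, ‖G φ‖ ≤ 1 := by
    intro φ
    rw [hG, norm_mul]
    refine mul_le_one₀ (Real.abs_sin_le_one φ) (norm_nonneg _) ?_
    have h1 := Real.exp_pos (-(ENNReal.ofReal (mu / (2 * Real.pi)) *
      visibleArc (Real.cos ξ) φ).toReal)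
    have h2 : Real.exp (-(ENNReal.ofReal (mu / (2 * Real.pi)) *
      visibleArc (Real.cos ξ) φ).toReal) ≤ 1 :=
      Real.exp_le_one_iff.2 (neg_nonpos.2 ENNReal.toReal_nonneg)
    rw [Real.norm_of_nonneg (by linarith)]
    linarith
  have hGi : ∀ a b, IntervalIntegrable G volume a b := fun a b =>
    (intervalIntegrable_const (c := (1 : ℝ))).mono_fun hGm.aestronglyMeasurable
      (ae_of_all _ fun x => (hGb x).trans (by simp))
  have hsymm : ∀ φ, G (Real.pi - φ) = G φ := fun φ => by
    simp only [hG, visibleArc, Real.sin_pi_sub]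
  have hhalf : ∫ φ in (0 : ℝ)..Real.pi, G φ = 2 * ∫ φ in (0 : ℝ)..Real.pi / 2, G φ := by
    rw [← intervalIntegral.integral_add_adjacent_intervals (hGi 0 (Real.pi / 2)) (hGi _ _)]
    have h := intervalIntegral.integral_comp_sub_left (a := (0 : ℝ)) (b := Real.pi / 2) G Real.pi
    simp only [hsymm] at h
    rw [sub_zero, show Real.pi - Real.pi / 2 = Real.pi / 2 by ring] at h
    rw [← h]
    ring
  have hsubst : ∫ φ in (0 : ℝ)..Real.pi / 2, G φ =
      ∫ ψ in (0 : ℝ)..Real.pi / 2, G (Real.pi / 2 - ψ) := by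
    rw [intervalIntegral.integral_comp_sub_left]
    simp
  have hGi' : ∀ a b, IntervalIntegrable (fun ψ => G (Real.pi / 2 - ψ)) volume a b := fun a b =>
    (intervalIntegrable_const (c := (1 : ℝ))).mono_fun
      (hGm.comp (measurable_const.sub measurable_id)).aestronglyMeasurable
      (ae_of_all _ fun x => (hGb _).trans (by simp))
  rw [hhalf, hsubst, ← intervalIntegral.integral_add_adjacent_intervals (hGi' 0 ξ) (hGi' _ _)]
  have hzero : ∫ ψ in ξ..Real.pi / 2, G (Real.pi / 2 - ψ) = 0 := by
    rw [intervalIntegral.integral_of_le hξ.le]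
    refine setIntegral_eq_zero_of_forall_eq_zero fun ψ hψ => ?_
    have hlt : Real.cos ψ < Real.cos ξ :=
      Real.cos_lt_cos_of_nonneg_of_le_pi_div_two hξ0 hψ.2 hψ.1
    have h0 : 0 ≤ Real.cos ψ :=
      Real.cos_nonneg_of_mem_Icc ⟨by linarith [hψ.1], hψ.2⟩
    simp only [hG, visibleArc, Real.sin_pi_div_two_sub, volume_cos_ge_of_lt h0 hlt]
    simp
  rw [hzero, add_zero]
  congr 1
  refine intervalIntegral.integral_congr fun ψ hψ => ?_
  rw [Set.uIcc_of_le hξ0] at hψ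
  have hle : Real.cos ξ ≤ Real.cos ψ :=
    Real.cos_le_cos_of_nonneg_of_le_pi hψ.1 (by linarith) hψ.2
  have hpos : 0 < Real.cos ψ := hc.trans_le hle
  have hacos : Real.arccos (Real.cos ξ / Real.cos ψ) =
      Real.arcsin (Real.sqrt (1 - Real.cos ξ ^ 2 * (1 / Real.cos ψ) ^ 2)) := by
    rw [Real.arccos_eq_arcsin (div_nonneg hc.le hpos.le)]
    congr 2
    ring
  simp only [hG, visibleArc, Real.sin_pi_div_two_sub, volume_cos_ge hc hle]
  rw [← ENNReal.ofReal_mul (by positivity), ENNReal.toReal_ofReal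
    (mul_nonneg (by positivity) (mul_nonneg zero_le_two (Real.arccos_nonneg _))), hacos]
  congr 3
  field_simp

/-! ### Harvesting at a fixed time -/

section

instance isFiniteMeasure_orbitIntensity (lam : ℝ) : IsFiniteMeasure (orbitIntensity lam) := by
  refine isFiniteMeasure_withDensity_ofReal (Integrable.hasFiniteIntegral ?_)
  refine ContinuousOn.integrableOn_compact (isCompact_Icc.prod isCompact_Icc) ?_
  fun_prop

lemma integral_orbitIntensity {lam : ℝ} (hlam : 0 ≤ lam) (g : ℝ → ℝ) :
    ∫ x, g x.2 ∂(orbitIntensity lam) =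
      lam / 2 * ∫ φ in (0 : ℝ)..Real.pi, Real.sin φ * g φ := by
  have hpi := Real.pi_pos
  have hset : MeasurableSet (Set.Icc 0 Real.pi ×ˢ Set.Icc 0 Real.pi) :=
    measurableSet_Icc.prod measurableSet_Icc
  rw [orbitIntensity, integral_withDensity_eq_integral_toReal_smul (by fun_prop)
    (ae_of_all _ fun x => ENNReal.ofReal_lt_top)]
  have h1 : ∫ x in Set.Icc 0 Real.pi ×ˢ Set.Icc 0 Real.pi,
      (ENNReal.ofReal (lam / (2 * Real.pi) * Real.sin x.2)).toReal • g x.2 =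
      ∫ x in Set.Icc 0 Real.pi ×ˢ Set.Icc 0 Real.pi,
        (lam / (2 * Real.pi)) * (Real.sin x.2 * g x.2) := by
    refine setIntegral_congr_fun hset fun x hx => ?_
    have hs : 0 ≤ Real.sin x.2 := Real.sin_nonneg_of_mem_Icc hx.2
    simp only [smul_eq_mul]
    rw [ENNReal.toReal_ofReal (by positivity), mul_assoc]
  rw [h1, Measure.volume_eq_prod, setIntegral_prod_mul (fun _ => lam / (2 * Real.pi))
    (fun φ => Real.sin φ * g φ), setIntegral_const,
    intervalIntegral.integral_of_le hpi.le, ← integral_Icc_eq_integral_Ioc]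
  simp only [measureReal_def, Real.volume_Icc, sub_zero, smul_eq_mul]
  rw [ENNReal.toReal_ofReal hpi.le]
  field_simp

variable {Ω : Type*} [MeasurableSpace Ω] {P : Measure Ω}
  {lam mu re ro γ : ℝ} {O : Ω → Measure (ℝ × ℝ)} {S : Ω → Measure ((ℝ × ℝ) × ℝ)}

lemma inRange_iff_visibleSet (hre : 0 < re) (hro : re < ro)
    (hγ : γ ∈ Set.Icc (ro - re) (Real.sqrt (ro ^ 2 - re ^ 2)))
    (hS : IsFinitePointProcess S) (vs we t : ℝ) (ω : Ω) :
    InRange S re ro γ vs we t ω ↔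
      S ω (visibleSet (Real.cos (capAngle re ro γ)) (vs / ro * t)) ≠ 0 := by
  have hset : satPosition ro vs we t ⁻¹' Metric.closedBall (typicalUser re) γ =
      visibleSet (Real.cos (capAngle re ro γ)) (vs / ro * t) :=
    Set.ext fun x => satPosition_mem_closedBall_iff hre hro hγ vs we t x
  rw [InRange, satellitesAt, Measure.map_apply (measurable_satPosition ro vs we t)
    Metric.isClosed_closedBall.measurableSet, hset,
    hS.one_le_iff ω (measurableSet_visibleSet _ _)]

lemma measurableSet_setOf_inRange (hre : 0 < re) (hro : re < ro)
    (hγ : γ ∈ Set.Icc (ro - re) (Real.sqrt (ro ^ 2 - re ^ 2)))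
    (hS : IsFinitePointProcess S) (vs we : ℝ) :
    MeasurableSet {p : ℝ × Ω | InRange S re ro γ vs we p.1 p.2} := by
  simp_rw [inRange_iff_visibleSet hre hro hγ hS]
  exact hS.measurable_apply_section
    (measurableSet_setOf_visibleSet (Real.cos (capAngle re ro γ)) (vs / ro))
    (measurableSet_singleton 0).compl

/-- The harvesting probability at a fixed time: the void probability of the Cox process is the
Laplace functional of the orbit process at `mu / (2 π)` times the length of the visible arc. -/
lemma measureReal_inRange [IsProbabilityMeasure P] (hlam : 0 ≤ lam) (hmu : 0 ≤ mu)
    (hre : 0 < re) (hro : re < ro)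
    (hγ : γ ∈ Set.Icc (ro - re) (Real.sqrt (ro ^ 2 - re ^ 2)))
    (hS : IsCoxConstellation P lam mu ro O S) (vs we t : ℝ) :
    P.real {ω | InRange S re ro γ vs we t ω} =
      harvestFormula lam mu (capAngle re ro γ) := by
  have hro0 : 0 < ro := hre.trans hro
  set ξ := capAngle re ro γ
  have hc : 0 < Real.cos ξ := (cos_capAngle hre hro hγ).2
  have hξ0 : 0 ≤ ξ := Real.arccos_nonneg _
  have hξ1 : ξ < Real.pi / 2 := by
    by_contra! h
    have := Real.cos_nonpos_of_pi_div_two_le_of_le h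
      (by have : ξ ≤ Real.pi := Real.arccos_le_pi _
          linarith [Real.pi_pos])
    linarith
  have hset : {ω | InRange S re ro γ vs we t ω} =
      {ω | S ω (visibleSet (Real.cos ξ) (vs / ro * t)) = 0}ᶜ :=
    Set.ext fun ω => inRange_iff_visibleSet hre hro hγ hS.satellites.toIsFinitePointProcess vs we t ω
  have hmeas : MeasurableSet {ω | S ω (visibleSet (Real.cos ξ) (vs / ro * t)) = 0} :=
    (Measure.measurable_coe (measurableSet_visibleSet _ _)).comp hS.satellites.measurable
      (measurableSet_singleton 0)
  have hm := measurable_visibleArc (Real.cos ξ)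
  rw [hset, probReal_compl_eq_one_sub hmeas,
    hS.satellites.measureReal_apply_eq_zero hS.orbits.measurable (measurableSet_visibleSet _ _)]
  simp_rw [satIntensity_visibleSet hro0]
  rw [hS.orbits.integral_exp_neg_lintegral
    (f := fun x => ENNReal.ofReal (mu / (2 * Real.pi)) * visibleArc (Real.cos ξ) x.2)
    (by fun_prop) (C := ENNReal.ofReal (mu / (2 * Real.pi)) * ENNReal.ofReal (2 * Real.pi))
    (ENNReal.mul_ne_top ENNReal.ofReal_ne_top ENNReal.ofReal_ne_top)
    (fun x => by gcongr; exact visibleArc_le _ _),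
    integral_orbitIntensity hlam (fun φ => 1 - Real.exp (-(ENNReal.ofReal (mu / (2 * Real.pi)) *
        visibleArc (Real.cos ξ) φ).toReal)),
    integral_sin_mul_visibleArc hmu hξ0 hξ1, harvestFormula]
  congr 2
  ring

end

/-! ### Time averages -/

section

/-- Time averages of a periodic function converge to its average over one period. -/
lemma tendsto_average_of_periodic {h : ℝ → ℝ} {T₀ : ℝ} (hT₀ : 0 < T₀)
    (hp : Function.Periodic h T₀) (hi : IntervalIntegrable h volume 0 T₀) :
    Tendsto (fun T => (∫ t in (0 : ℝ)..T, h t) / T) atTop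
      (𝓝 ((∫ t in (0 : ℝ)..T₀, h t) / T₀)) := by
  set A := ∫ t in (0 : ℝ)..T₀, h t
  have hfloor : Tendsto (fun T : ℝ => (⌊T / T₀⌋ : ℝ) * A / T) atTop (𝓝 (A / T₀)) := by
    have h1 := (tendsto_nat_floor_mul_div_atTop (inv_nonneg.2 hT₀.le)).mul_const A
    rw [inv_mul_eq_div] at h1
    refine h1.congr' ?_
    filter_upwards [eventually_ge_atTop 0] with T hT
    rw [inv_mul_eq_div, natCast_floor_eq_intCast_floor (div_nonneg hT hT₀.le), div_mul_eq_mul_div]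
  have hX : ∀ X : ℝ, Tendsto (fun T : ℝ => (X + ⌊T / T₀⌋ • A) / T) atTop (𝓝 (A / T₀)) := by
    intro X
    have := (tendsto_const_nhds (x := X)).div_atTop tendsto_id |>.add hfloor
    simpa [add_div] using this
  refine tendsto_of_tendsto_of_tendsto_of_le_of_le'
    (hX (sInf ((fun t => ∫ x in (0 : ℝ)..t, h x) '' Set.Icc 0 T₀)))
    (hX (sSup ((fun t => ∫ x in (0 : ℝ)..t, h x) '' Set.Icc 0 T₀))) ?_ ?_
  · filter_upwards [eventually_gt_atTop 0] with T hT
    exact div_le_div_of_nonneg_right (hp.sInf_add_zsmul_le_integral_of_pos hi hT₀ T) hT.le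
  · filter_upwards [eventually_gt_atTop 0] with T hT
    exact div_le_div_of_nonneg_right (hp.integral_le_sSup_add_zsmul_of_pos hi hT₀ T) hT.le

variable {Ω : Type*} [MeasurableSpace Ω] {P : Measure Ω}
  {lam mu re ro γ : ℝ} {O : Ω → Measure (ℝ × ℝ)} {S : Ω → Measure ((ℝ × ℝ) × ℝ)}

/-- Fubini: if the event of being in range has the same probability at all times, this is also
the mean fraction of time in any time window. -/
lemma integral_timeFraction [IsProbabilityMeasure P] {vs we p : ℝ}
    (hm : MeasurableSet {q : ℝ × Ω | InRange S re ro γ vs we q.1 q.2})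
    (hp : ∀ t, P.real {ω | InRange S re ro γ vs we t ω} = p) {T : ℝ} (hT : 0 < T) :
    Integrable (timeFraction S re ro γ vs we T) P ∧
      ∫ ω, timeFraction S re ro γ vs we T ω ∂P = p := by
  set ν : Measure ℝ := volume.restrict (Set.Icc 0 T)
  have hν : ν Set.univ = ENNReal.ofReal T := by simp [ν]
  have hv : ∀ ω, volume {t ∈ Set.Icc 0 T | InRange S re ro γ vs we t ω} =
      ν ((fun t => (t, ω)) ⁻¹' {q : ℝ × Ω | InRange S re ro γ vs we q.1 q.2}) := fun ω => by
    rw [Measure.restrict_apply (measurable_prodMk_right hm), Set.inter_comm]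
    rfl
  have hle : ∀ ω, volume {t ∈ Set.Icc 0 T | InRange S re ro γ vs we t ω} ≤ ENNReal.ofReal T :=
    fun ω => by rw [hv, ← hν]; exact measure_mono (Set.subset_univ _)
  have hmeas : Measurable fun ω => volume {t ∈ Set.Icc 0 T | InRange S re ro γ vs we t ω} := by
    simp_rw [hv]
    exact measurable_measure_prodMk_right hm
  have htf : timeFraction S re ro γ vs we T = fun ω =>
    (volume {t ∈ Set.Icc 0 T | InRange S re ro γ vs we t ω}).toReal / T := rfl
  refine ⟨?_, ?_⟩
  · rw [htf]
    refine Integrable.div_const (Integrable.of_bound hmeas.ennreal_toReal.aestronglyMeasurable T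
      (ae_of_all _ fun ω => ?_)) T
    rw [Real.norm_of_nonneg ENNReal.toReal_nonneg]
    exact ENNReal.toReal_le_of_le_ofReal hT.le (hle ω)
  · have hp' : ∀ t, P (Prod.mk t ⁻¹' {q : ℝ × Ω | InRange S re ro γ vs we q.1 q.2}) =
        ENNReal.ofReal p := fun t => by
      rw [← hp t, ofReal_measureReal]
      rfl
    have hp0 : 0 ≤ p := hp 0 ▸ measureReal_nonneg
    rw [htf, integral_div, integral_toReal hmeas.aemeasurable
      (ae_of_all _ fun ω => (hle ω).trans_lt ENNReal.ofReal_lt_top)]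
    simp_rw [hv]
    rw [← Measure.prod_apply_symm hm, Measure.prod_apply hm]
    simp_rw [hp']
    rw [lintegral_const, hν, ENNReal.toReal_mul, ENNReal.toReal_ofReal hp0,
      ENNReal.toReal_ofReal hT.le, mul_div_assoc, div_self hT.ne', mul_one]

/-- Being in range recurs with the period of revolution of the satellites, although the
positions need not: the rotation of the orbits about the axis of the cap is not visible. -/
lemma inRange_add_period (hre : 0 < re) (hro : re < ro)
    (hγ : γ ∈ Set.Icc (ro - re) (Real.sqrt (ro ^ 2 - re ^ 2))) (hS : IsFinitePointProcess S)
    {vs : ℝ} (hvs : 0 < vs) (we t : ℝ) (ω : Ω) :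
    InRange S re ro γ vs we (t + 2 * Real.pi / (vs / ro)) ω ↔ InRange S re ro γ vs we t ω := by
  have hv : vs / ro ≠ 0 := (div_pos hvs (hre.trans hro)).ne'
  have hset : ∀ c, visibleSet c (vs / ro * (t + 2 * Real.pi / (vs / ro))) =
      visibleSet c (vs / ro * t) := fun c => by
    rw [mul_add, mul_div_cancel₀ _ hv]
    simp only [visibleSet, ← add_assoc, Real.sin_add_two_pi]
  rw [inRange_iff_visibleSet hre hro hγ hS, inRange_iff_visibleSet hre hro hγ hS, hset]

lemma tendsto_timeFraction (hre : 0 < re) (hro : re < ro)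
    (hγ : γ ∈ Set.Icc (ro - re) (Real.sqrt (ro ^ 2 - re ^ 2))) (hS : IsFinitePointProcess S)
    {vs : ℝ} (hvs : 0 < vs) (we : ℝ) (ω : Ω) :
    Tendsto (fun T => timeFraction S re ro γ vs we T ω) atTop
      (𝓝 (timeFraction S re ro γ vs we (2 * Real.pi / (vs / ro)) ω)) := by
  have hT₀ : 0 < 2 * Real.pi / (vs / ro) :=
    div_pos Real.two_pi_pos (div_pos hvs (hre.trans hro))
  set I : Set ℝ := {t | InRange S re ro γ vs we t ω}
  have hIm : MeasurableSet I :=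
    measurable_prodMk_right (measurableSet_setOf_inRange hre hro hγ hS vs we)
  have heq : ∀ T, 0 ≤ T → timeFraction S re ro γ vs we T ω =
      (∫ t in (0 : ℝ)..T, I.indicator (fun _ => (1 : ℝ)) t) / T := by
    intro T hT
    rw [intervalIntegral.integral_of_le hT, ← integral_Icc_eq_integral_Ioc,
      setIntegral_indicator hIm, setIntegral_const, smul_eq_mul, mul_one]
    rfl
  have hp : Function.Periodic (I.indicator fun _ => (1 : ℝ)) (2 * Real.pi / (vs / ro)) := by
    intro t
    have ht : t + 2 * Real.pi / (vs / ro) ∈ I ↔ t ∈ I :=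
      inRange_add_period hre hro hγ hS hvs we t ω
    by_cases h : t ∈ I
    · rw [Set.indicator_of_mem h, Set.indicator_of_mem (ht.2 h)]
    · rw [Set.indicator_of_notMem h, Set.indicator_of_notMem (mt ht.1 h)]
  have hi : IntervalIntegrable (I.indicator fun _ => (1 : ℝ)) volume 0
      (2 * Real.pi / (vs / ro)) := by
    rw [intervalIntegrable_iff]
    exact IntegrableOn.indicator (by simp) hIm
  rw [heq _ hT₀.le]
  refine (tendsto_average_of_periodic hT₀ hp hi).congr' ?_
  filter_upwards [eventually_ge_atTop 0] with T hT using (heq T hT).symm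

end

end LEO

theorem theorem1 {Ω : Type*} [MeasurableSpace Ω] (P : Measure Ω) [IsProbabilityMeasure P]
    (lam mu re ro γ vs we : ℝ) (hlam : 0 ≤ lam) (hmu : 0 ≤ mu)
    (hre : 0 < re) (hro : re < ro)
    (hγ : γ ∈ Set.Icc (ro - re) (Real.sqrt (ro ^ 2 - re ^ 2)))
    (hvs : 0 < vs)
    (O : Ω → Measure (ℝ × ℝ)) (S : Ω → Measure ((ℝ × ℝ) × ℝ))
    (hS : LEO.IsCoxConstellation P lam mu ro O S) :
    -- the long-run fraction of time exists almost surely, and its mean is given by the formula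
    (∃ F : Ω → ℝ, Integrable F P ∧
      (∀ᵐ ω ∂P, Tendsto (fun T => LEO.timeFraction S re ro γ vs we T ω) atTop (𝓝 (F ω))) ∧
      ∫ ω, F ω ∂P = LEO.harvestFormula lam mu (LEO.capAngle re ro γ)) ∧
    -- so is the mean fraction of time in every time window
    (∀ T : ℝ, 0 < T → Integrable (LEO.timeFraction S re ro γ vs we T) P ∧
      ∫ ω, LEO.timeFraction S re ro γ vs we T ω ∂P
        = LEO.harvestFormula lam mu (LEO.capAngle re ro γ)) ∧
    -- and the probability of a satellite within range at any given time
    (∀ t : ℝ, MeasurableSet {ω | LEO.InRange S re ro γ vs we t ω} ∧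
      P.real {ω | LEO.InRange S re ro γ vs we t ω}
        = LEO.harvestFormula lam mu (LEO.capAngle re ro γ)) := by
  have hfin := hS.satellites.toIsFinitePointProcess
  have hm := LEO.measurableSet_setOf_inRange hre hro hγ hfin vs we
  have hp := LEO.measureReal_inRange hlam hmu hre hro hγ hS vs we
  have hT := fun (T : ℝ) (h : 0 < T) => LEO.integral_timeFraction hm hp h
  obtain ⟨hi, he⟩ := hT (2 * Real.pi / (vs / ro))
    (div_pos Real.two_pi_pos (div_pos hvs (hre.trans hro)))
  exact ⟨⟨_, hi, ae_of_all _ (LEO.tendsto_timeFraction hre hro hγ hfin hvs we), he⟩, hT,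
    fun t => ⟨measurable_prodMk_left hm, hp t⟩⟩
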